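/- Let $G$ be a finite group, $n\in\mathbb N$, and let $\pi\colon G\to \mathrm{SU}(n)$ be a non-trivial homomorphism such that the representation of $G$ on $\mathbb C^n$ given by $\pi$ is irreducible. Let $\mathrm{PU}(n)=\mathrm U(n)/S^1$, with the quotient topology, and let $\bar\pi\colon G\to \mathrm{PU}(n)$ be the composition of $\pi$ with the natural map $\mathrm{SU}(n)\to\mathrm{PU}(n)$. A torus in $\mathrm{SU}(n)$ is a compact connected abelian subgroup; it is non-trivial if it is not $\{1\}$. Let $\mathfrak{su}(n)$ be the real Lie algebra of skew-Hermitian $n\times n$ matrices of trace $0$, on which $G$ acts by conjugation through $\pi$. Consider the condition (T) $\pi(G)$ does not normalize any non-trivial torus in $\mathrm{SU}(n)$. Then: 1. Condition (T) holds if and only if every $\pi(G)$-invariant abelian Lie subalgebra of $\mathfrak{su}(n)$ is $\{0\}$. 2. Condition (T) holds if every homomorphism from $G$ to the symmetric group $\mathrm{Sym}(n)$ is trivial. 3. Condition (T) holds if $\pi$ is of least dimension, that is, if every non-trivial irreducible finite-dimensional complex representation of $G$ has dimension at least $n$. 4. If (T) holds, then the set of discrete subgroups of $\mathrm{PU}(n)$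 containing $\bar\pi(G)$ is uniformly discrete: there is a neighbourhood $U$ of $1$ in $\mathrm{PU}(n)$ such that $H\cap U=\{1\}$ for every discrete subgroup $H\le\mathrm{PU}(n)$ with $\bar\pi(G)\le H$. Moreover, $\bar\pi(G)$ is contained in a subgroup $M\le\mathrm{PU}(n)$ that is maximal among the discrete subgroups of $\mathrm{PU}(n)$, and $M$ is finite. -/

import Mathlib

open scoped Topology Matrix

-- matrices form a real Lie algebra under the commutator bracket
attribute [local instance 100] LieRing.ofAssociativeRing

noncomputable section

/-- The scalar matrices of modulus one, i.e. the circle `S¹ · 1`, as a subgroup of `U(n)`. -/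
def scalarCircle (n : ℕ) : Subgroup (Matrix.unitaryGroup (Fin n) ℂ) where
  carrier := {u | ∃ z : ℂ, ‖z‖ = 1 ∧ (u : Matrix (Fin n) (Fin n) ℂ) = z • 1}
  one_mem' := ⟨1, by simp, by simp⟩
  mul_mem' := by
    rintro a b ⟨z, hz, ha⟩ ⟨w, hw, hb⟩
    refine ⟨z * w, by simp [hz, hw], ?_⟩
    rw [Submonoid.coe_mul, ha, hb]
    simp [smul_smul, mul_comm]
  inv_mem' := by
    rintro a ⟨z, hz, ha⟩
    refine ⟨star z, by simp [hz], ?_⟩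
    rw [Matrix.UnitaryGroup.inv_val, ha]
    simp

instance scalarCircle_normal (n : ℕ) : (scalarCircle n).Normal where
  conj_mem := by
    rintro a ⟨z, hz, ha⟩ g
    refine ⟨z, hz, ?_⟩
    have hg : (g : Matrix (Fin n) (Fin n) ℂ) * ((g⁻¹ : Matrix.unitaryGroup (Fin n) ℂ) :
        Matrix (Fin n) (Fin n) ℂ) = 1 := by
      rw [← Submonoid.coe_mul, mul_inv_cancel, Submonoid.coe_one]
    rw [Submonoid.coe_mul, Submonoid.coe_mul, ha]
    simpa using congrArg (fun M => z • M) hg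

/-- The projective unitary group `PU(n) = U(n) / S¹`. Its group structure and its topology are
those of the quotient, where `U(n)` carries the topology of a subspace of the matrices. -/
abbrev PU (n : ℕ) : Type := Matrix.unitaryGroup (Fin n) ℂ ⧸ scalarCircle n

/-- The natural homomorphism `SU(n) → U(n) → PU(n)`. -/
def toPU (n : ℕ) : Matrix.specialUnitaryGroup (Fin n) ℂ →* PU n :=
  (QuotientGroup.mk' (scalarCircle n)).comp
    (Submonoid.inclusion Matrix.specialUnitaryGroup_le_unitaryGroup)

/-- The linear representation on `ℂⁿ` given by a homomorphism into `SU(n)`. -/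
def repOfSU {G : Type*} [Group G] {n : ℕ} (π : G →* Matrix.specialUnitaryGroup (Fin n) ℂ) :
    Representation ℂ G (Fin n → ℂ) where
  toFun g := Matrix.toLin' (π g : Matrix (Fin n) (Fin n) ℂ)
  map_one' := by simp [Module.End.one_eq_id]
  map_mul' g h := by simp [Matrix.toLin'_mul, Module.End.mul_eq_comp]

/-- A torus in `SU(n)`: a compact, connected, abelian subgroup. -/
structure IsTorus {n : ℕ} (T : Subgroup (Matrix.specialUnitaryGroup (Fin n) ℂ)) : Prop where
  isCompact : IsCompact (T : Set (Matrix.specialUnitaryGroup (Fin n) ℂ))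
  isConnected : IsConnected (T : Set (Matrix.specialUnitaryGroup (Fin n) ℂ))
  comm : ∀ s ∈ T, ∀ t ∈ T, s * t = t * s

/-- The image of `π` normalizes no torus of `SU(n)` other than `{1}`. -/
def NormalizesNoTorus {G : Type*} [Group G] {n : ℕ}
    (π : G →* Matrix.specialUnitaryGroup (Fin n) ℂ) : Prop :=
  ∀ T : Subgroup (Matrix.specialUnitaryGroup (Fin n) ℂ), IsTorus T →
    π.range ≤ Subgroup.normalizer (T : Set (Matrix.specialUnitaryGroup (Fin n) ℂ)) → T = ⊥

/-- The real Lie algebra `𝔰𝔲(n)` of skew-Hermitian matrices of trace zero. -/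
def suLie (n : ℕ) : LieSubalgebra ℝ (Matrix (Fin n) (Fin n) ℂ) where
  carrier := {X | Xᴴ = -X ∧ X.trace = 0}
  zero_mem' := by simp
  add_mem' := by
    rintro X Y ⟨hX, tX⟩ ⟨hY, tY⟩
    exact ⟨by rw [Matrix.conjTranspose_add, hX, hY, neg_add], by simp [tX, tY]⟩
  smul_mem' := by
    rintro c X ⟨hX, tX⟩
    exact ⟨by simp [Matrix.conjTranspose_smul, hX], by simp [tX]⟩
  lie_mem' := by
    rintro X Y ⟨hX, tX⟩ ⟨hY, tY⟩
    refine ⟨?_, ?_⟩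
    · rw [Ring.lie_def, Matrix.conjTranspose_sub, Matrix.conjTranspose_mul,
        Matrix.conjTranspose_mul, hX, hY]
      noncomm_ring
    · rw [Ring.lie_def, Matrix.trace_sub, Matrix.trace_mul_comm, sub_self]

/-- A Lie subalgebra of matrices that is invariant under conjugation by all `π g`. -/
def AdInvariant {G : Type*} [Group G] {n : ℕ} (π : G →* Matrix.specialUnitaryGroup (Fin n) ℂ)
    (𝔞 : LieSubalgebra ℝ (Matrix (Fin n) (Fin n) ℂ)) : Prop :=
  ∀ g : G, ∀ X ∈ 𝔞, (π g : Matrix (Fin n) (Fin n) ℂ) * X *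
    ((π g)⁻¹ : Matrix.specialUnitaryGroup (Fin n) ℂ) ∈ 𝔞

/-- A set of subgroups of a topological group is uniformly discrete if a single neighbourhood of
the identity meets each of them only in the identity. -/
def UniformlyDiscrete {K : Type*} [Group K] [TopologicalSpace K] (S : Set (Subgroup K)) : Prop :=
  ∃ U ∈ 𝓝 (1 : K), ∀ H ∈ S, ∀ x ∈ H, x ∈ U → x = 1

/-- A discrete subgroup that is maximal among the discrete subgroups. -/
def IsMaximalDiscrete {K : Type*} [Group K] [TopologicalSpace K] (M : Subgroup K) : Prop :=
  Maximal (fun H : Subgroup K => DiscreteTopology H) M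

end

noncomputable section

/-! ### Commuting invariant families and the double centralizer -/

section
variable {n : ℕ}

/-! Everything passes through the Lie condition (L): no non-zero invariant abelian subalgebra of
𝔰𝔲(n). An invariant abelian subalgebra 𝔞 yields the normalized torus given by the closure of exp 𝔞,
so (T) implies (L).

The main use of (L) is `exists_eq_smul_one_of_commute`: the traceless skew-Hermitian part of the
double centralizer of an invariant, self-adjoint, commuting family is an invariant abelian
subalgebra, so it vanishes and the family is scalar. For a normalized torus this gives scalars of
determinant 1, a finite set, and connectedness makes the torus trivial. For a discrete H, a
Zassenhaus argument (`commute_of_mem_discrete`) shows that the lifts of elements of H near 1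
commute; they are then scalar, that is, trivial in PU(n). The neighbourhood does not depend on H, so
Zorn and compactness give a finite maximal discrete overgroup.

For the two criteria, G permutes the joint generalised eigenspaces of 𝔞, and an orbit has at most n
members. If it has one, that space is everything by irreducibility, and each X in 𝔞 has a single
eigenvalue, so X = 0. Otherwise G acts transitively on between 2 and n points, which gives a
non-trivial map to Sym(n) and, through the functions of sum zero, a non-trivial irreducible
representation of dimension below n. -/

theorem coe_mul_coe_inv (a : Matrix.specialUnitaryGroup (Fin n) ℂ) :
    (a : Matrix (Fin n) (Fin n) ℂ) *
      ((a⁻¹ : Matrix.specialUnitaryGroup (Fin n) ℂ) : Matrix (Fin n) (Fin n) ℂ) = 1 := by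
  rw [← Submonoid.coe_mul, mul_inv_cancel, Submonoid.coe_one]

theorem coe_inv_mul_coe (a : Matrix.specialUnitaryGroup (Fin n) ℂ) :
    ((a⁻¹ : Matrix.specialUnitaryGroup (Fin n) ℂ) : Matrix (Fin n) (Fin n) ℂ) *
      (a : Matrix (Fin n) (Fin n) ℂ) = 1 := by
  rw [← Submonoid.coe_mul, inv_mul_cancel, Submonoid.coe_one]

theorem coe_inv_eq_conjTranspose (a : Matrix.specialUnitaryGroup (Fin n) ℂ) :
    ((a⁻¹ : Matrix.specialUnitaryGroup (Fin n) ℂ) : Matrix (Fin n) (Fin n) ℂ) =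
      (a : Matrix (Fin n) (Fin n) ℂ)ᴴ := rfl

theorem conj_mem_suLie (a : Matrix.specialUnitaryGroup (Fin n) ℂ)
    {X : Matrix (Fin n) (Fin n) ℂ} (hX : X ∈ suLie n) :
    (a : Matrix (Fin n) (Fin n) ℂ) * X *
      ((a⁻¹ : Matrix.specialUnitaryGroup (Fin n) ℂ) : Matrix (Fin n) (Fin n) ℂ) ∈ suLie n := by
  obtain ⟨h1, h2⟩ := hX
  refine ⟨?_, ?_⟩
  · rw [coe_inv_eq_conjTranspose, Matrix.conjTranspose_mul, Matrix.conjTranspose_mul, h1,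
      Matrix.conjTranspose_conjTranspose]
    noncomm_ring
  · rw [Matrix.trace_mul_comm, ← mul_assoc, coe_inv_mul_coe, one_mul, h2]

/-- The skew-Hermitian trace-zero elements of the double centralizer of a set of matrices. -/
def suDoubleCentralizer (S : Set (Matrix (Fin n) (Fin n) ℂ)) :
    LieSubalgebra ℝ (Matrix (Fin n) (Fin n) ℂ) where
  carrier := {X | X ∈ suLie n ∧ X ∈ Subalgebra.centralizer ℂ (Set.centralizer S)}
  zero_mem' := ⟨zero_mem _, zero_mem _⟩
  add_mem' hX hY := ⟨add_mem hX.1 hY.1, add_mem hX.2 hY.2⟩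
  smul_mem' c X hX := ⟨(suLie n).smul_mem c hX.1, by
    have := Subalgebra.smul_mem _ hX.2 (c : ℂ)
    simpa using this⟩
  lie_mem' hX hY := ⟨(suLie n).lie_mem hX.1 hY.1, by
    rw [Ring.lie_def]
    exact sub_mem (mul_mem hX.2 hY.2) (mul_mem hY.2 hX.2)⟩

/-- If every invariant abelian subalgebra of `𝔰𝔲(n)` vanishes, then an invariant self-adjoint family
of commuting matrices consists of scalars. -/
theorem exists_eq_smul_one_of_commute {G : Type*} [Group G]
    (π : G →* Matrix.specialUnitaryGroup (Fin n) ℂ)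
    (hL : ∀ 𝔞 : LieSubalgebra ℝ (Matrix (Fin n) (Fin n) ℂ),
        𝔞 ≤ suLie n → IsLieAbelian 𝔞 → AdInvariant π 𝔞 → 𝔞 = ⊥)
    {S : Set (Matrix (Fin n) (Fin n) ℂ)} (hcomm : ∀ s ∈ S, ∀ t ∈ S, s * t = t * s)
    (hstar : ∀ s ∈ S, sᴴ ∈ S)
    (hconj : ∀ g : G, ∀ s ∈ S, (π g : Matrix (Fin n) (Fin n) ℂ) * s *
      ((π g)⁻¹ : Matrix.specialUnitaryGroup (Fin n) ℂ) ∈ S)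
    {s : Matrix (Fin n) (Fin n) ℂ} (hs : s ∈ S) : ∃ z : ℂ, s = z • 1 := by
  rcases Nat.eq_zero_or_pos n with rfl | hn
  · exact ⟨0, Subsingleton.elim _ _⟩
  have hn' : (n : ℂ) ≠ 0 := by exact_mod_cast hn.ne'
  -- Writing S' for the centralizer, commutativity says S ⊆ S', whence S'' ⊆ S': the double
  -- centralizer is commutative.
  have hSC : S ⊆ Set.centralizer S := fun s hs t ht => hcomm t ht s hs
  have hCC : Set.centralizer (Set.centralizer S) ⊆ Set.centralizer S :=
    Set.centralizer_subset hSC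
  have hSCC : ∀ t ∈ S, t ∈ Subalgebra.centralizer ℂ (Set.centralizer S) :=
    fun t ht => Set.subset_centralizer_centralizer ht
  have hbot : suDoubleCentralizer S = ⊥ := by
    refine hL _ (fun X hX => hX.1) ⟨?_⟩ ?_
    · rintro ⟨X, -, hX⟩ ⟨Y, -, hY⟩
      refine Subtype.ext ?_
      change ⁅X, Y⁆ = 0
      rw [Ring.lie_def, sub_eq_zero]
      exact hY X (hCC hX)
    · rintro g X ⟨h1, h2⟩
      refine ⟨conj_mem_suLie _ h1, ?_⟩
      intro Y hY
      set a : Matrix (Fin n) (Fin n) ℂ := (π g : Matrix (Fin n) (Fin n) ℂ)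
      set b : Matrix (Fin n) (Fin n) ℂ :=
        (((π g)⁻¹ : Matrix.specialUnitaryGroup (Fin n) ℂ) : Matrix (Fin n) (Fin n) ℂ)
      have hab : a * b = 1 := coe_mul_coe_inv _
      have hba : b * a = 1 := coe_inv_mul_coe _
      -- As S is invariant under conjugation, so is its centralizer, and hence the double
      -- centralizer.
      have hY' : b * Y * a ∈ Set.centralizer S := by
        intro t ht
        have := hY _ (hconj g t ht)
        change a * t * b * Y = Y * (a * t * b) at this
        calc t * (b * Y * a) = (b * a) * t * (b * Y * a) := by rw [hba, one_mul]
          _ = b * (a * t * b * Y) * a := by noncomm_ring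
          _ = b * Y * a * t * (b * a) := by rw [this]; noncomm_ring
          _ = b * Y * a * t := by rw [hba, mul_one]
      have := h2 _ hY'
      change Y * (a * X * b) = a * X * b * Y
      calc Y * (a * X * b) = (a * b) * Y * (a * X * b) := by rw [hab, one_mul]
        _ = a * (b * Y * a * X) * b := by noncomm_ring
        _ = a * X * b * Y * (a * b) := by rw [this]; noncomm_ring
        _ = a * X * b * Y := by rw [hab, mul_one]
  -- The trace of a skew-Hermitian X is imaginary, so removing the scalar part tr(X)/n leaves an
  -- element of `suDoubleCentralizer S`.
  have key : ∀ X ∈ Subalgebra.centralizer ℂ (Set.centralizer S), Xᴴ = -X →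
      ∃ z : ℂ, X = z • 1 := by
    intro X hX hskew
    refine ⟨X.trace / n, ?_⟩
    have htr : star X.trace = - X.trace := by
      rw [← Matrix.trace_conjTranspose, hskew, Matrix.trace_neg]
    have hmem : X - (X.trace / n) • (1 : Matrix (Fin n) (Fin n) ℂ) ∈ suDoubleCentralizer S := by
      refine ⟨⟨?_, ?_⟩, sub_mem hX (Subalgebra.smul_mem _ (one_mem _) _)⟩
      · rw [Matrix.conjTranspose_sub, Matrix.conjTranspose_smul, hskew, star_div₀, htr]
        simp [neg_div]
        abel
      · simp [hn']
    rw [hbot, LieSubalgebra.mem_bot, sub_eq_zero] at hmem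
    exact hmem
  -- Both s − sᴴ and i(s + sᴴ) are skew-Hermitian, and together they determine s.
  obtain ⟨z, hz⟩ := key (s - sᴴ) (sub_mem (hSCC s hs) (hSCC _ (hstar s hs))) (by simp)
  obtain ⟨w, hw⟩ := key (Complex.I • (s + sᴴ))
    (Subalgebra.smul_mem _ (add_mem (hSCC s hs) (hSCC _ (hstar s hs))) _)
    (by simp [Matrix.conjTranspose_smul, add_comm])
  refine ⟨z / 2 - Complex.I * w / 2, ?_⟩
  have h2 : s + sᴴ = (-Complex.I * w) • (1 : Matrix (Fin n) (Fin n) ℂ) := by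
    rw [mul_smul, ← hw, smul_smul]; simp
  have h3 : (2 : ℂ) • s = (s - sᴴ) + (s + sᴴ) := by rw [two_smul]; abel
  rw [hz, h2, ← add_smul] at h3
  have h4 : s = (2⁻¹ : ℂ) • ((2 : ℂ) • s) := by rw [smul_smul]; norm_num
  rw [h4, h3, smul_smul]
  congr 1
  ring

end

/-! ### Commutators near the identity in unitary groups -/

section
open Filter

/-- A normed algebra has no small multiplicative submonoids: an element all of whose powers stay
at distance less than one from `1` is `1`. -/
theorem eq_one_of_forall_norm_pow_sub_one_le {A : Type*} [NormedRing A] [NormedAlgebra ℂ A] {c : A}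
    {r : ℝ} (hr : r < 1) (h : ∀ m : ℕ, ‖c ^ m - 1‖ ≤ r) : c = 1 := by
  have hr0 : 0 ≤ r := (norm_nonneg _).trans (h 0)
  have key : ∀ k m : ℕ, ‖c ^ m - 1‖ ≤ r * ((1 + r) / 2) ^ k := by
    intro k
    induction k with
    | zero => simpa using h
    | succ k ih =>
      intro m
      -- Comparing c^m with c^(2m) turns a bound B valid for all powers into B(1 + r)/2.
      have e : (2 : ℂ) • (c ^ m - 1) = (c ^ (m * 2) - 1) - (c ^ m - 1) * (c ^ m - 1) := by
        rw [two_smul, pow_mul, sq]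
        noncomm_ring
      have h1 : ‖(2 : ℂ) • (c ^ m - 1)‖ = 2 * ‖c ^ m - 1‖ := by
        rw [norm_smul]; simp
      have h2 := norm_sub_le (c ^ (m * 2) - 1) ((c ^ m - 1) * (c ^ m - 1))
      rw [← e, h1] at h2
      have h3 := norm_mul_le (c ^ m - 1) (c ^ m - 1)
      have h4 : ‖c ^ m - 1‖ * ‖c ^ m - 1‖ ≤ (r * ((1 + r) / 2) ^ k) * r :=
        mul_le_mul (ih m) (h m) (norm_nonneg _) (by positivity)
      have h5 := ih (m * 2)
      rw [pow_succ]
      linarith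
  have hlim : Tendsto (fun k : ℕ => r * ((1 + r) / 2) ^ k) atTop (𝓝 0) := by
    simpa using (tendsto_pow_atTop_nhds_zero_of_lt_one (by positivity)
      (by linarith : (1 + r) / 2 < 1)).const_mul r
  have h0 : ‖c ^ 1 - 1‖ ≤ 0 := ge_of_tendsto' hlim fun k => key k 1
  simpa [sub_eq_zero] using h0

variable {A : Type*} [NormedRing A] [StarRing A] [CStarRing A]

theorem norm_unitary_conj_sub_one (u w : unitary A) :
    ‖((u * w * u⁻¹ : unitary A) : A) - 1‖ = ‖(w : A) - 1‖ := by
  have : ((u * w * u⁻¹ : unitary A) : A) - 1 = u * ((w : A) - 1) * (u⁻¹ : unitary A) := by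
    have h : (u : A) * ((u⁻¹ : unitary A) : A) = 1 := by
      rw [← Submonoid.coe_mul, mul_inv_cancel, Submonoid.coe_one]
    rw [mul_sub, sub_mul, mul_one, h]
    simp
  rw [this, CStarRing.norm_mul_coe_unitary, CStarRing.norm_coe_unitary_mul]

theorem norm_unitary_inv_sub_one (u : unitary A) :
    ‖((u⁻¹ : unitary A) : A) - 1‖ = ‖(u : A) - 1‖ := by
  have : ((u⁻¹ : unitary A) : A) - 1 = star ((u : A) - 1) := by
    rw [star_sub, star_one, ← Unitary.star_eq_inv, Unitary.coe_star]
  rw [this, norm_star]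

/-- The commutator minus 1 is the additive commutator of u − 1 and w − 1 times a unitary, so it is
quadratically small; iterated commutators therefore contract. -/
theorem norm_unitary_commutator_sub_one_le (u w : unitary A) :
    ‖((u * w * u⁻¹ * w⁻¹ : unitary A) : A) - 1‖ ≤ 2 * ‖(u : A) - 1‖ * ‖(w : A) - 1‖ := by
  have h1 : ((u * w * u⁻¹ * w⁻¹ : unitary A) : A) - 1 =
      (((u : A) - 1) * ((w : A) - 1) - ((w : A) - 1) * ((u : A) - 1)) *
        ((u⁻¹ * w⁻¹ : unitary A) : A) := by
    have h : (w : A) * (u : A) * ((u⁻¹ * w⁻¹ : unitary A) : A) = 1 := by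
      rw [← Submonoid.coe_mul, ← Submonoid.coe_mul]
      simp [mul_assoc]
    have e : (((u : A) - 1) * ((w : A) - 1) - ((w : A) - 1) * ((u : A) - 1)) =
        (u : A) * w - w * u := by noncomm_ring
    rw [e, sub_mul, h]
    simp [mul_assoc]
  rw [h1, CStarRing.norm_mul_coe_unitary]
  refine (norm_sub_le _ _).trans ?_
  have h2 := norm_mul_le ((u : A) - 1) ((w : A) - 1)
  have h3 := norm_mul_le ((w : A) - 1) ((u : A) - 1)
  linarith

variable [NormedAlgebra ℂ A]

/-- If `u` commutes with the commutator of `u` and `w`, and `w` is close to `1`, then `u` commutes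
with `w`. -/
theorem commute_of_commute_commutator {u w : unitary A} (hw : ‖(w : A) - 1‖ ≤ 1 / 4)
    (h : Commute u (u * w * u⁻¹ * w⁻¹)) : Commute u w := by
  set c := u * w * u⁻¹ * w⁻¹ with hc
  have hconj : u * w * u⁻¹ = c * w := by simp [hc]
  -- Since u commutes with c, conjugating w by u^m multiplies it by c^m. Conjugation keeps the
  -- distance to 1, so every c^m stays within 2 · 1/4 of 1, which forces c = 1.
  have hpow : ∀ m : ℕ, u ^ m * w * (u ^ m)⁻¹ = c ^ m * w := by
    intro m
    induction m with
    | zero => simp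
    | succ m ih =>
      have h' : u * c ^ m = c ^ m * u := h.pow_right m
      calc u ^ (m + 1) * w * (u ^ (m + 1))⁻¹ = u * (u ^ m * w * (u ^ m)⁻¹) * u⁻¹ := by
            rw [pow_succ']; group
        _ = c ^ m * (u * w * u⁻¹) := by rw [ih, ← mul_assoc, h']; group
        _ = c ^ (m + 1) * w := by rw [hconj, pow_succ, mul_assoc (c ^ m) c w]
  have hc1 : (c : A) = 1 := by
    refine eq_one_of_forall_norm_pow_sub_one_le (r := 1 / 2) (by norm_num) fun m => ?_
    have e : ((c : A) ^ m - 1) * w = (((u ^ m * w * (u ^ m)⁻¹ : unitary A) : A) - 1) - (w - 1) := by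
      rw [hpow]
      simp [sub_mul]
    rw [← CStarRing.norm_mul_coe_unitary _ w, e]
    refine (norm_sub_le _ _).trans ?_
    rw [norm_unitary_conj_sub_one]
    linarith
  have hc1' : c = 1 := Subtype.ext hc1
  rw [hc1', one_mul, mul_inv_eq_iff_eq_mul] at hconj
  exact hconj

/-- In the quotient of a unitary group by a central subgroup, elements of a discrete subgroup having
representatives close to `1` commute; even the representatives do. -/
theorem commute_of_mem_discrete {N : Subgroup (unitary A)} [N.Normal]
    (hN : N ≤ Subgroup.center (unitary A)) {H : Subgroup (unitary A ⧸ N)} [DiscreteTopology H]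
    {u v : unitary A} (huH : (u : unitary A ⧸ N) ∈ H) (hvH : (v : unitary A ⧸ N) ∈ H)
    (hu : ‖(u : A) - 1‖ ≤ 1 / 4) (hv : ‖(v : A) - 1‖ ≤ 1 / 4) : Commute u v := by
  -- The iterated commutators [u, [u, …, v]] stay over H and tend to 1, with factor 2 · 1/4;
  -- discreteness puts some s k in the central subgroup N.
  set s : ℕ → unitary A := fun k => (fun w => u * w * u⁻¹ * w⁻¹)^[k] v with hs
  have hsucc : ∀ k, s (k + 1) = u * s k * u⁻¹ * (s k)⁻¹ := fun k =>
    Function.iterate_succ_apply' _ _ _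
  have hH : ∀ k, (s k : unitary A ⧸ N) ∈ H := by
    intro k
    induction k with
    | zero => exact hvH
    | succ k ih =>
      rw [hsucc]
      exact H.mul_mem (H.mul_mem (H.mul_mem huH ih) (H.inv_mem huH)) (H.inv_mem ih)
  have hnorm : ∀ k, ‖(s k : A) - 1‖ ≤ 1 / 4 * (1 / 2) ^ k := by
    intro k
    induction k with
    | zero => rw [pow_zero, mul_one]; exact hv
    | succ k ih =>
      rw [hsucc]
      refine (norm_unitary_commutator_sub_one_le _ _).trans ?_
      have : ‖(u : A) - 1‖ * ‖(s k : A) - 1‖ ≤ 1 / 4 * (1 / 4 * (1 / 2) ^ k) :=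
        mul_le_mul hu ih (norm_nonneg _) (by norm_num)
      rw [pow_succ]
      linarith
  have hnorm' : ∀ k, ‖(s k : A) - 1‖ ≤ 1 / 4 := fun k => (hnorm k).trans <| by
    have : ((1 : ℝ) / 2) ^ k ≤ 1 := pow_le_one₀ (by norm_num) (by norm_num)
    linarith
  have hlim : Tendsto s atTop (𝓝 1) := by
    rw [tendsto_subtype_rng, tendsto_iff_norm_sub_tendsto_zero]
    refine squeeze_zero (fun _ => norm_nonneg _) hnorm ?_
    have := (tendsto_pow_atTop_nhds_zero_of_lt_one (by norm_num)
      (by norm_num : (1 : ℝ) / 2 < 1)).const_mul (1 / 4)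
    rwa [mul_zero] at this
  have hlim' : Tendsto (fun k => (⟨s k, hH k⟩ : H)) atTop (𝓝 1) := by
    rw [tendsto_subtype_rng]
    exact (QuotientGroup.continuous_mk.tendsto (1 : unitary A)).comp hlim
  rw [nhds_discrete, tendsto_pure] at hlim'
  obtain ⟨k, hk⟩ := hlim'.exists
  have hk' : s k ∈ N := by
    rw [← QuotientGroup.eq_one_iff]
    exact congrArg Subtype.val hk
  have hk0 : Commute u (s k) := Subgroup.mem_center_iff.1 (hN hk') u
  -- Descend from s k to s 0 = v: commuting with [u, s i] implies commuting with s i.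
  have hdesc : ∀ j ≤ k, Commute u (s (k - j)) := by
    intro j
    induction j with
    | zero => intro _; exact hk0
    | succ j ih =>
      intro hj
      refine commute_of_commute_commutator (hnorm' _) ?_
      rw [← hsucc, show k - (j + 1) + 1 = k - j by omega]
      exact ih (by omega)
  simpa [hs] using hdesc k le_rfl

end

/-! ### Uniform discreteness in PU(n) and maximal discrete subgroups -/

section
open scoped Matrix.Norms.L2Operator
variable {n : ℕ}

theorem scalarCircle_le_center :
    scalarCircle n ≤ Subgroup.center (Matrix.unitaryGroup (Fin n) ℂ) := by
  rintro a ⟨z, -, ha⟩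
  rw [Subgroup.mem_center_iff]
  intro b
  refine Subtype.ext ?_
  rw [Submonoid.coe_mul, Submonoid.coe_mul, ha]
  simp

theorem isClosed_unitaryGroup :
    IsClosed (Matrix.unitaryGroup (Fin n) ℂ : Set (Matrix (Fin n) (Fin n) ℂ)) :=
  isClosed_unitary

theorem isCompact_unitaryGroup :
    IsCompact (Matrix.unitaryGroup (Fin n) ℂ : Set (Matrix (Fin n) (Fin n) ℂ)) := by
  have : ProperSpace (Matrix (Fin n) (Fin n) ℂ) := FiniteDimensional.proper ℂ _
  refine Metric.isCompact_of_isClosed_isBounded isClosed_unitaryGroup ?_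
  refine (Metric.isBounded_closedBall (x := (0 : Matrix (Fin n) (Fin n) ℂ)) (r := ‖(1 : Matrix (Fin n) (Fin n) ℂ)‖)).subset ?_
  intro u hu
  rw [mem_closedBall_zero_iff]
  rw [← mul_one u, CStarRing.norm_mem_unitary_mul _ hu]

instance compactSpace_unitaryGroup : CompactSpace (Matrix.unitaryGroup (Fin n) ℂ) :=
  isCompact_iff_compactSpace.1 isCompact_unitaryGroup

theorem isClosed_scalarCircle :
    IsClosed (scalarCircle n : Set (Matrix.unitaryGroup (Fin n) ℂ)) := by
  have h : IsCompact ((fun z : ℂ => z • (1 : Matrix (Fin n) (Fin n) ℂ)) '' Metric.sphere 0 1) :=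
    (isCompact_sphere _ _).image (by fun_prop)
  convert h.isClosed.preimage continuous_subtype_val using 1
  ext u
  constructor
  · rintro ⟨z, hz, hu⟩
    exact ⟨z, by simpa using hz, hu.symm⟩
  · rintro ⟨z, hz, hu⟩
    exact ⟨z, by simpa using hz, hu.symm⟩

instance t3Space_PU : T3Space (PU n) :=
  haveI : IsClosed (scalarCircle n : Set (Matrix.unitaryGroup (Fin n) ℂ)) := isClosed_scalarCircle
  inferInstance

theorem mem_scalarCircle_of_eq_smul_one {u : Matrix.unitaryGroup (Fin n) ℂ} {z : ℂ}
    (hu : (u : Matrix (Fin n) (Fin n) ℂ) = z • 1) : u ∈ scalarCircle n := by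
  rcases isEmpty_or_nonempty (Fin n) with h | ⟨⟨i⟩⟩
  · exact ⟨1, norm_one, Subsingleton.elim _ _⟩
  refine ⟨z, ?_, hu⟩
  have h := congrFun (congrFun (Matrix.mem_unitaryGroup_iff.1 u.2) i) i
  rw [hu] at h
  have h2 : (‖z‖ : ℂ) ^ 2 = 1 := by
    simpa [Matrix.mul_apply, Matrix.one_apply, Complex.mul_conj'] using h
  have h3 : ‖z‖ ^ 2 = 1 := by exact_mod_cast h2
  exact (pow_eq_one_iff_of_nonneg (norm_nonneg z) two_ne_zero).1 h3

theorem discreteTopology_of_nhds {K : Type*} [Group K] [TopologicalSpace K] [IsTopologicalGroup K]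
    {U : Set K} (hU : U ∈ 𝓝 (1 : K)) {H : Subgroup K} (h : ∀ x ∈ H, x ∈ U → x = 1) :
    DiscreteTopology H := by
  rw [discreteTopology_iff_isOpen_singleton_one, isOpen_singleton_iff_nhds_eq_pure]
  refine le_antisymm ?_ (pure_le_nhds _)
  rw [Filter.le_pure_iff]
  have : ((↑) : H → K) ⁻¹' U ∈ 𝓝 (1 : H) :=
    continuous_subtype_val.continuousAt.preimage_mem_nhds hU
  exact Filter.mem_of_superset this fun x hx => Subtype.ext (h x x.2 hx)

theorem uniformlyDiscrete_of_forall_abelian_eq_bot {G : Type*} [Group G]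
    (π : G →* Matrix.specialUnitaryGroup (Fin n) ℂ)
    (hL : ∀ 𝔞 : LieSubalgebra ℝ (Matrix (Fin n) (Fin n) ℂ),
        𝔞 ≤ suLie n → IsLieAbelian 𝔞 → AdInvariant π 𝔞 → 𝔞 = ⊥) :
    UniformlyDiscrete
        {H : Subgroup (PU n) | DiscreteTopology H ∧ ((toPU n).comp π).range ≤ H} := by
  refine ⟨((↑) : Matrix.unitaryGroup (Fin n) ℂ → PU n) ''
    {u | ‖(u : Matrix (Fin n) (Fin n) ℂ) - 1‖ < 1 / 4}, ?_, ?_⟩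
  · refine (QuotientGroup.isOpenMap_coe _ ?_).mem_nhds ⟨1, by simp, rfl⟩
    exact isOpen_lt (by fun_prop) continuous_const
  rintro H ⟨hd, hle⟩ - hx ⟨u, hu, rfl⟩
  -- All lifts near 1 of elements of H. Unitary invariance of the operator norm makes this set
  -- stable under adjoints and under conjugation by π(G).
  set S : Set (Matrix (Fin n) (Fin n) ℂ) := {s | ∃ u : Matrix.unitaryGroup (Fin n) ℂ,
    (u : PU n) ∈ H ∧ ‖(u : Matrix (Fin n) (Fin n) ℂ) - 1‖ ≤ 1 / 4 ∧ s = u}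
  have hcomm : ∀ s ∈ S, ∀ t ∈ S, s * t = t * s := by
    rintro - ⟨v, hv, hv', rfl⟩ - ⟨w, hw, hw', rfl⟩
    exact congrArg Subtype.val (commute_of_mem_discrete scalarCircle_le_center hv hw hv' hw').eq
  have hstar : ∀ s ∈ S, sᴴ ∈ S := by
    rintro - ⟨v, hv, hv', rfl⟩
    exact ⟨v⁻¹, H.inv_mem hv, by rwa [norm_unitary_inv_sub_one], rfl⟩
  have hconj : ∀ g : G, ∀ s ∈ S, (π g : Matrix (Fin n) (Fin n) ℂ) * s *
      ((π g)⁻¹ : Matrix.specialUnitaryGroup (Fin n) ℂ) ∈ S := by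
    rintro g - ⟨v, hv, hv', rfl⟩
    set a : Matrix.unitaryGroup (Fin n) ℂ :=
      Submonoid.inclusion Matrix.specialUnitaryGroup_le_unitaryGroup (π g)
    have ha : (a : PU n) ∈ H := hle ⟨g, rfl⟩
    exact ⟨a * v * a⁻¹, H.mul_mem (H.mul_mem ha hv) (H.inv_mem ha),
      by rwa [norm_unitary_conj_sub_one], rfl⟩
  obtain ⟨z, hz⟩ := exists_eq_smul_one_of_commute π hL hcomm hstar hconj ⟨u, hx, hu.le, rfl⟩
  exact (QuotientGroup.eq_one_iff u).2 (mem_scalarCircle_of_eq_smul_one hz)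

/-- A finite subgroup of a compact group over which the discrete subgroups are uniformly discrete
lies in a maximal discrete subgroup, which is finite. -/
theorem exists_isMaximalDiscrete {K : Type*} [Group K] [TopologicalSpace K] [IsTopologicalGroup K]
    [CompactSpace K] [T2Space K] {F : Subgroup K} [Finite F]
    (h : UniformlyDiscrete {H : Subgroup K | DiscreteTopology H ∧ F ≤ H}) :
    ∃ M : Subgroup K, IsMaximalDiscrete M ∧ Finite M ∧ F ≤ M := by
  obtain ⟨U, hU, hdisc⟩ := h
  have hchain : ∀ c ⊆ {H : Subgroup K | DiscreteTopology H ∧ F ≤ H}, IsChain (· ≤ ·) c →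
      ∀ H ∈ c, ∃ ub ∈ {H : Subgroup K | DiscreteTopology H ∧ F ≤ H}, ∀ H ∈ c, H ≤ ub := by
    intro c hc hchain H hH
    -- A chain's supremum is its union, which still meets the common neighbourhood U only in 1.
    refine ⟨sSup c, ⟨discreteTopology_of_nhds hU ?_, (hc hH).2.trans (le_sSup hH)⟩,
      fun _ => le_sSup⟩
    intro x hx hxU
    obtain ⟨H', hH', hxH'⟩ := (Subgroup.mem_sSup_of_directedOn ⟨H, hH⟩ hchain.directedOn).1 hx
    exact hdisc H' (hc hH') x hxH' hxU
  obtain ⟨M, hFM, hM⟩ := zorn_le_nonempty₀ _ hchain F ⟨inferInstance, le_rfl⟩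
  have hMd : DiscreteTopology M := hM.prop.1
  refine ⟨M, ⟨hMd, fun H hH hle => hM.le_of_ge ⟨hH, hFM.trans hle⟩ hle⟩, ?_, hFM⟩
  have : CompactSpace M := isCompact_iff_compactSpace.1 Subgroup.isClosed_of_discrete.isCompact
  exact finite_of_compact_of_discrete

end

/-! ### Tori and invariant abelian subalgebras -/

section
open scoped Matrix.Norms.L2Operator
variable {n : ℕ}

instance isTopologicalGroup_specialUnitaryGroup :
    IsTopologicalGroup (Matrix.specialUnitaryGroup (Fin n) ℂ) where
  continuous_inv := by
    refine Continuous.subtype_mk (f := fun a : Matrix.specialUnitaryGroup (Fin n) ℂ =>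
      star (a : Matrix (Fin n) (Fin n) ℂ)) ?_ _
    fun_prop

instance compactSpace_specialUnitaryGroup :
    CompactSpace (Matrix.specialUnitaryGroup (Fin n) ℂ) := by
  refine isCompact_iff_compactSpace.1 (isCompact_unitaryGroup.of_isClosed_subset ?_
    Matrix.specialUnitaryGroup_le_unitaryGroup)
  have : (Matrix.specialUnitaryGroup (Fin n) ℂ : Set (Matrix (Fin n) (Fin n) ℂ)) =
      (Matrix.unitaryGroup (Fin n) ℂ : Set (Matrix (Fin n) (Fin n) ℂ)) ∩ {a | a.det = 1} := by
    ext a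
    exact Matrix.mem_specialUnitaryGroup_iff
  rw [this]
  exact isClosed_unitaryGroup.inter (isClosed_eq (by fun_prop) continuous_const)

/-- Determinant 1 forces zⁿ = 1. A connected group of such scalars is then trivial. -/
theorem finite_scalars_specialUnitaryGroup :
    {a : Matrix.specialUnitaryGroup (Fin n) ℂ |
      ∃ z : ℂ, (a : Matrix (Fin n) (Fin n) ℂ) = z • 1}.Finite := by
  rcases Nat.eq_zero_or_pos n with rfl | hn
  · exact Set.toFinite _
  have hroots : {z : ℂ | z ^ n = 1}.Finite := by
    have := (Polynomial.nthRootsFinset n (1 : ℂ)).finite_toSet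
    refine this.subset fun z hz => ?_
    rw [Finset.mem_coe, Polynomial.mem_nthRootsFinset hn]
    exact hz
  refine Set.Finite.of_finite_image ((hroots.image fun z : ℂ =>
    z • (1 : Matrix (Fin n) (Fin n) ℂ)).subset ?_) Subtype.val_injective.injOn
  rintro - ⟨a, ⟨z, hz⟩, rfl⟩
  refine ⟨z, ?_, hz.symm⟩
  have := (Matrix.mem_specialUnitaryGroup_iff.1 a.2).2
  rw [hz] at this
  simpa using this

theorem normalizesNoTorus_of_forall_abelian_eq_bot {G : Type*} [Group G]
    (π : G →* Matrix.specialUnitaryGroup (Fin n) ℂ)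
    (hL : ∀ 𝔞 : LieSubalgebra ℝ (Matrix (Fin n) (Fin n) ℂ),
        𝔞 ≤ suLie n → IsLieAbelian 𝔞 → AdInvariant π 𝔞 → 𝔞 = ⊥) :
    NormalizesNoTorus π := by
  intro T hT hnorm
  have hscalar : ∀ t ∈ T, ∃ z : ℂ, (t : Matrix (Fin n) (Fin n) ℂ) = z • 1 := by
    intro t ht
    refine exists_eq_smul_one_of_commute π hL
      (S := ((↑) : _ → Matrix (Fin n) (Fin n) ℂ) '' (T : Set _)) ?_ ?_ ?_ ⟨t, ht, rfl⟩
    · rintro - ⟨a, ha, rfl⟩ - ⟨b, hb, rfl⟩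
      exact congrArg Subtype.val (hT.comm a ha b hb)
    · rintro - ⟨a, ha, rfl⟩
      exact ⟨a⁻¹, T.inv_mem ha, rfl⟩
    · rintro g - ⟨a, ha, rfl⟩
      exact ⟨π g * a * (π g)⁻¹,
        (Subgroup.mem_normalizer_iff.1 (hnorm ⟨g, rfl⟩) a).1 ha, rfl⟩
  have hfin : (T : Set (Matrix.specialUnitaryGroup (Fin n) ℂ)).Finite :=
    finite_scalars_specialUnitaryGroup.subset hscalar
  have hsub := hfin.countable.isTotallyDisconnected _ subset_rfl hT.isConnected.isPreconnected
  exact (Subgroup.eq_bot_iff_forall T).2 fun t ht => hsub ht T.one_mem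

theorem exp_mem_unitaryGroup {X : Matrix (Fin n) (Fin n) ℂ} (hX : X ∈ suLie n) :
    NormedSpace.exp X ∈ Matrix.unitaryGroup (Fin n) ℂ :=
  let +nondep : NormedAlgebra ℚ (Matrix (Fin n) (Fin n) ℂ) := .restrictScalars ℚ ℂ _
  NormedSpace.exp_mem_unitary_of_mem_skewAdjoint (skewAdjoint.mem_iff.2 hX.1)

/-- Diagonalising the Hermitian matrix −iX reduces det exp X = exp tr X to the diagonal case. -/
theorem det_exp_of_mem_suLie {X : Matrix (Fin n) (Fin n) ℂ} (hX : X ∈ suLie n) :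
    (NormedSpace.exp X).det = 1 := by
  obtain ⟨h1, h2⟩ := hX
  have hA : ((-Complex.I) • X).IsHermitian := by
    rw [Matrix.IsHermitian, Matrix.conjTranspose_smul, h1]
    simp
  have hXA : X = Complex.I • ((-Complex.I) • X) := by rw [smul_smul]; simp
  set V : Matrix (Fin n) (Fin n) ℂ := (hA.eigenvectorUnitary : Matrix (Fin n) (Fin n) ℂ)
  set D : Fin n → ℂ := Complex.I • (RCLike.ofReal ∘ hA.eigenvalues)
  have hV : V * star V = 1 := Unitary.coe_mul_star_self hA.eigenvectorUnitary
  have hV' : star V * V = 1 := Unitary.coe_star_mul_self hA.eigenvectorUnitary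
  have hinv : V⁻¹ = star V := Matrix.inv_eq_right_inv hV
  have hunit : IsUnit V := ⟨⟨V, star V, hV, hV'⟩, rfl⟩
  have hXD : X = V * Matrix.diagonal D * V⁻¹ := by
    conv_lhs => rw [hXA, hA.spectral_theorem, Unitary.conjStarAlgAut_apply]
    rw [hinv, Matrix.diagonal_smul, Matrix.mul_smul, Matrix.smul_mul]
  have htr : ∑ i, D i = 0 := by
    rw [hXD, Matrix.trace_mul_comm, hinv, ← mul_assoc, hV', one_mul, Matrix.trace_diagonal] at h2
    exact h2
  have hVdet : V.det * V⁻¹.det = 1 := by rw [← Matrix.det_mul, hinv, hV, Matrix.det_one]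
  rw [hXD, Matrix.exp_conj _ _ hunit, Matrix.exp_diagonal, Matrix.det_mul, Matrix.det_mul,
    Matrix.det_diagonal, mul_right_comm, hVdet, one_mul]
  simp_rw [Pi.coe_exp]
  rw [← NormedSpace.exp_sum, htr, NormedSpace.exp_zero]

/-- The exponential map `𝔰𝔲(n) → SU(n)`. -/
def expSU (X : suLie n) : Matrix.specialUnitaryGroup (Fin n) ℂ :=
  ⟨NormedSpace.exp (X : Matrix (Fin n) (Fin n) ℂ), Matrix.mem_specialUnitaryGroup_iff.2
    ⟨exp_mem_unitaryGroup X.2, det_exp_of_mem_suLie X.2⟩⟩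

theorem continuous_expSU : Continuous (expSU : suLie n → _) :=
  let +nondep : NormedAlgebra ℚ (Matrix (Fin n) (Fin n) ℂ) := .restrictScalars ℚ ℂ _
  Continuous.subtype_mk (NormedSpace.exp_continuous.comp continuous_subtype_val) _

theorem conj_expSU (a : Matrix.specialUnitaryGroup (Fin n) ℂ) (X : suLie n) :
    a * expSU X * a⁻¹ = expSU ⟨_, conj_mem_suLie a X.2⟩ := by
  refine Subtype.ext ?_
  have hinv : (a : Matrix (Fin n) (Fin n) ℂ)⁻¹ =
      ((a⁻¹ : Matrix.specialUnitaryGroup (Fin n) ℂ) : Matrix (Fin n) (Fin n) ℂ) :=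
    Matrix.inv_eq_right_inv (coe_mul_coe_inv a)
  change (a : Matrix (Fin n) (Fin n) ℂ) * NormedSpace.exp (X : Matrix (Fin n) (Fin n) ℂ) *
    ((a⁻¹ : Matrix.specialUnitaryGroup (Fin n) ℂ) : Matrix (Fin n) (Fin n) ℂ) =
    NormedSpace.exp ((a : Matrix (Fin n) (Fin n) ℂ) * (X : Matrix (Fin n) (Fin n) ℂ) *
    ((a⁻¹ : Matrix.specialUnitaryGroup (Fin n) ℂ) : Matrix (Fin n) (Fin n) ℂ))
  rw [← hinv, Matrix.exp_conj]
  exact ⟨⟨_, _, coe_mul_coe_inv a, coe_inv_mul_coe a⟩, rfl⟩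

theorem commute_of_isLieAbelian {𝔞 : LieSubalgebra ℝ (Matrix (Fin n) (Fin n) ℂ)}
    [IsLieAbelian 𝔞] {X Y : Matrix (Fin n) (Fin n) ℂ} (hX : X ∈ 𝔞) (hY : Y ∈ 𝔞) :
    Commute X Y := by
  have h : ⁅(⟨X, hX⟩ : 𝔞), (⟨Y, hY⟩ : 𝔞)⁆ = 0 := trivial_lie_zero _ _ _ _
  have h' : ⁅X, Y⁆ = 0 := congrArg Subtype.val h
  rwa [Ring.lie_def, sub_eq_zero] at h'

/-- The subgroup of exponentials of an abelian subalgebra of `𝔰𝔲(n)`. -/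
def expSubgroup (𝔞 : LieSubalgebra ℝ (Matrix (Fin n) (Fin n) ℂ)) (hle : 𝔞 ≤ suLie n)
    [IsLieAbelian 𝔞] : Subgroup (Matrix.specialUnitaryGroup (Fin n) ℂ) where
  carrier := Set.range fun X : 𝔞 => expSU ⟨X, hle X.2⟩
  one_mem' := ⟨0, Subtype.ext NormedSpace.exp_zero⟩
  mul_mem' := by
    rintro - - ⟨X, rfl⟩ ⟨Y, rfl⟩
    exact ⟨X + Y, Subtype.ext
      (Matrix.exp_add_of_commute _ _ (commute_of_isLieAbelian X.2 Y.2))⟩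
  inv_mem' := by
    rintro - ⟨X, rfl⟩
    refine ⟨-X, Subtype.ext ?_⟩
    change NormedSpace.exp (-(X : Matrix (Fin n) (Fin n) ℂ)) =
      star (NormedSpace.exp (X : Matrix (Fin n) (Fin n) ℂ))
    rw [NormedSpace.star_exp]
    exact congrArg _ (hle X.2).1.symm

/-- The image exp 𝔞 need not be closed, as irrational windings show; its closure is compact and
remains connected and abelian. -/
theorem isTorus_topologicalClosure_expSubgroup (𝔞 : LieSubalgebra ℝ (Matrix (Fin n) (Fin n) ℂ))
    (hle : 𝔞 ≤ suLie n) [IsLieAbelian 𝔞] : IsTorus (expSubgroup 𝔞 hle).topologicalClosure where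
  isCompact := (Subgroup.isClosed_topologicalClosure _).isCompact
  isConnected := by
    have hconv : IsConnected (𝔞 : Set (Matrix (Fin n) (Fin n) ℂ)) :=
      ⟨⟨0, zero_mem _⟩, (𝔞.toSubmodule.convex).isPreconnected⟩
    have : ConnectedSpace 𝔞 := isConnected_iff_connectedSpace.1 hconv
    refine IsConnected.closure (s := Set.range fun X : 𝔞 => expSU ⟨X, hle X.2⟩)
      (isConnected_range (continuous_expSU.comp ?_))
    exact Continuous.subtype_mk continuous_subtype_val _
  comm := by
    let _ := (expSubgroup 𝔞 hle).commGroupTopologicalClosure (by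
      rintro ⟨-, X, rfl⟩ ⟨-, Y, rfl⟩
      refine Subtype.ext (Subtype.ext ?_)
      exact ((commute_of_isLieAbelian X.2 Y.2).exp).eq)
    intro s hs t ht
    exact congrArg Subtype.val (mul_comm (⟨s, hs⟩ : (expSubgroup 𝔞 hle).topologicalClosure) ⟨t, ht⟩)

/-- X is the derivative of t ↦ exp(tX) at 0. -/
theorem eq_zero_of_exp_smul_eq_one {X : Matrix (Fin n) (Fin n) ℂ}
    (h : ∀ t : ℝ, NormedSpace.exp (t • X) = 1) : X = 0 := by
  have h1 := hasDerivAt_exp_smul_const (𝕂 := ℝ) X 0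
  simp_rw [h] at h1
  simpa using h1.unique (hasDerivAt_const _ _)

theorem abelian_eq_bot_of_normalizesNoTorus {G : Type*} [Group G]
    (π : G →* Matrix.specialUnitaryGroup (Fin n) ℂ) (hT : NormalizesNoTorus π)
    (𝔞 : LieSubalgebra ℝ (Matrix (Fin n) (Fin n) ℂ)) (hle : 𝔞 ≤ suLie n) (hab : IsLieAbelian 𝔞)
    (hinv : AdInvariant π 𝔞) : 𝔞 = ⊥ := by
  have hconj : ∀ g : G, ∀ t ∈ (expSubgroup 𝔞 hle).topologicalClosure,
      π g * t * (π g)⁻¹ ∈ (expSubgroup 𝔞 hle).topologicalClosure := by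
    intro g t ht
    refine map_mem_closure (f := fun t => π g * t * (π g)⁻¹) (by fun_prop) ht ?_
    rintro - ⟨X, rfl⟩
    change π g * expSU ⟨X, hle X.2⟩ * (π g)⁻¹ ∈ expSubgroup 𝔞 hle
    rw [conj_expSU]
    exact ⟨⟨_, hinv g X X.2⟩, rfl⟩
  have hbot := hT _ (isTorus_topologicalClosure_expSubgroup 𝔞 hle) (by
    rintro - ⟨g, rfl⟩
    refine Subgroup.mem_normalizer_iff.2 fun t => ⟨hconj g t, fun ht => ?_⟩
    have := hconj g⁻¹ _ ht
    rw [map_inv, inv_inv] at this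
    convert this using 1
    group)
  refine (LieSubalgebra.eq_bot_iff _).2 fun X hX => eq_zero_of_exp_smul_eq_one fun t => ?_
  have hmem : expSU ⟨t • X, hle (𝔞.smul_mem t hX)⟩ ∈ (expSubgroup 𝔞 hle).topologicalClosure :=
    subset_closure ⟨⟨t • X, 𝔞.smul_mem t hX⟩, rfl⟩
  rw [hbot, Subgroup.mem_bot] at hmem
  exact congrArg Subtype.val hmem

end

/-! ### Irreducible constituents and permutation representations -/

section
variable {k G V V' : Type*} [Field k] [Group G] [AddCommGroup V] [Module k V]
  [AddCommGroup V'] [Module k V']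

theorem Representation.isIrreducible_iff (ρ : Representation k G V) :
    ρ.IsIrreducible ↔ Nontrivial V ∧
      ∀ W : Submodule k V, (∀ g, ∀ v ∈ W, ρ g v ∈ W) → W = ⊥ ∨ W = ⊤ := by
  constructor
  · intro h
    refine ⟨?_, fun W hW => ?_⟩
    · by_contra hV
      rw [not_nontrivial_iff_subsingleton] at hV
      exact bot_ne_top (α := Subrepresentation ρ)
        (Subrepresentation.toSubmodule_injective (Subsingleton.elim _ _))
    · exact (h.eq_bot_or_eq_top ⟨W, fun g v => hW g v⟩).imp
        (congrArg Subrepresentation.toSubmodule) (congrArg Subrepresentation.toSubmodule)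
  · rintro ⟨hV, h⟩
    exact
      { exists_pair_ne := ⟨⊥, ⊤, fun e =>
          bot_ne_top (α := Submodule k V) (congrArg Subrepresentation.toSubmodule e)⟩
        eq_bot_or_eq_top := fun W => (h W.toSubmodule fun g v hv => W.apply_mem_toSubmodule g hv).imp
          (fun e => Subrepresentation.toSubmodule_injective e)
          (fun e => Subrepresentation.toSubmodule_injective e) }

/-- Transport of a representation along a linear equivalence. -/
def Representation.transport (ρ : Representation k G V) (e : V ≃ₗ[k] V') :
    Representation k G V' where
  toFun g := e.conj (ρ g)
  map_one' := by ext; simp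
  map_mul' g h := by ext; simp

theorem Representation.IsIrreducible.transport {ρ : Representation k G V} (h : ρ.IsIrreducible)
    (e : V ≃ₗ[k] V') : (ρ.transport e).IsIrreducible := by
  rw [Representation.isIrreducible_iff] at h ⊢
  obtain ⟨hV, h⟩ := h
  refine ⟨e.symm.toEquiv.nontrivial, fun W hW => ?_⟩
  have hmap : W = (W.comap (e : V →ₗ[k] V')).map (e : V →ₗ[k] V') :=
    (Submodule.map_comap_eq_of_surjective e.surjective W).symm
  refine (h (W.comap (e : V →ₗ[k] V')) fun g v hv => ?_).imp (fun e' => ?_) fun e' => ?_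
  · have := hW g (e v) hv
    simpa [Representation.transport] using this
  · rw [hmap, e', Submodule.map_bot]
  · rw [hmap, e', Submodule.map_top, LinearEquiv.range]

/-- Over the complex numbers, a nontrivial representation of a finite group has a nontrivial
irreducible constituent. -/
theorem Representation.exists_isIrreducible_ne_one [Finite G] {V : Type*} [AddCommGroup V]
    [Module ℂ V] [FiniteDimensional ℂ V] (ρ : Representation ℂ G V) (hρ : ρ ≠ 1) :
    ∃ m ≤ Module.finrank ℂ V, ∃ σ : Representation ℂ G (Fin m → ℂ), σ.IsIrreducible ∧ σ ≠ 1 := by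
  induction hd : Module.finrank ℂ V using Nat.strong_induction_on generalizing V with
  | _ d ih =>
  by_cases hirr : ρ.IsIrreducible
  · let e : V ≃ₗ[ℂ] (Fin d → ℂ) := (Module.finBasisOfFinrankEq ℂ V hd).equivFun
    refine ⟨d, le_rfl, ρ.transport e, hirr.transport e, fun h => hρ ?_⟩
    refine MonoidHom.ext fun g => LinearMap.ext fun v => e.injective ?_
    have := LinearMap.congr_fun (DFunLike.congr_fun h g) (e v)
    simpa [Representation.transport] using this
  have hV : Nontrivial V := by
    by_contra hV
    rw [not_nontrivial_iff_subsingleton] at hV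
    exact hρ (MonoidHom.ext fun g => LinearMap.ext fun v => Subsingleton.elim _ _)
  obtain ⟨W, hWbot, hWtop⟩ : ∃ W : Subrepresentation ρ, W ≠ ⊥ ∧ W ≠ ⊤ := by
    by_contra! hcon
    refine hirr ((Representation.isIrreducible_iff ρ).2 ⟨hV, fun W hW => ?_⟩)
    by_contra! hne
    exact hne.2 (congrArg Subrepresentation.toSubmodule (hcon ⟨W, fun g v => hW g v⟩
      fun e => hne.1 (congrArg Subrepresentation.toSubmodule e)))
  have hsmall : ∀ W : Subrepresentation ρ, W ≠ ⊤ → W.toRepresentation ≠ 1 → ∃ m ≤ d,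
      ∃ σ : Representation ℂ G (Fin m → ℂ), σ.IsIrreducible ∧ σ ≠ 1 := by
    intro W hW hne
    have hlt : Module.finrank ℂ W.toSubmodule < d := hd ▸ Submodule.finrank_lt
      fun e => hW (Subrepresentation.toSubmodule_injective e)
    obtain ⟨m, hm, h⟩ := ih _ hlt W.toRepresentation hne rfl
    exact ⟨m, hm.trans hlt.le, h⟩
  -- By Maschke, W has an invariant complement; if G acted trivially on both summands, ρ would be
  -- trivial.
  obtain ⟨W', hW'⟩ := exists_isCompl W
  by_contra hcon
  have h1 : W.toRepresentation = 1 := by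
    by_contra h
    exact hcon (hsmall W hWtop h)
  have h2 : W'.toRepresentation = 1 := by
    by_contra h
    refine hcon (hsmall W' (fun e => hWbot ?_) h)
    rw [e] at hW'
    exact disjoint_top.1 hW'.disjoint
  have hfix : ∀ W : Subrepresentation ρ, W.toRepresentation = 1 → ∀ g, ∀ v ∈ W.toSubmodule,
      ρ g v = v := fun W h g v hv =>
    congrArg Subtype.val (LinearMap.congr_fun (DFunLike.congr_fun h g) ⟨v, hv⟩)
  refine hρ (MonoidHom.ext fun g => LinearMap.ext fun v => ?_)
  have hv : v ∈ W.toSubmodule ⊔ W'.toSubmodule := by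
    rw [← Subrepresentation.toSubmodule_sup, hW'.sup_eq_top]
    exact Submodule.mem_top
  obtain ⟨x, hx, y, hy, rfl⟩ := Submodule.mem_sup.1 hv
  rw [map_add, hfix W h1 g x hx, hfix W' h2 g y hy]
  rfl

/-- The permutation representation on the functions on a `G`-set. -/
def permRep (G Ω : Type*) [Group G] [MulAction G Ω] : Representation ℂ G (Ω → ℂ) where
  toFun g := LinearMap.funLeft ℂ ℂ fun ω => g⁻¹ • ω
  map_one' := by ext; simp
  map_mul' g h := by
    refine LinearMap.ext fun φ => funext fun ω => ?_
    simp [LinearMap.funLeft_apply, mul_smul]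

/-- The functions of sum zero, as a subrepresentation of the permutation representation. -/
def permRepSumZero (G Ω : Type*) [Group G] [MulAction G Ω] [Fintype Ω] :
    Subrepresentation (permRep G Ω) where
  toSubmodule := LinearMap.ker (∑ ω : Ω, LinearMap.proj (R := ℂ) (φ := fun _ : Ω => ℂ) ω)
  apply_mem_toSubmodule g φ hφ := by
    simp only [LinearMap.mem_ker, LinearMap.sum_apply, LinearMap.proj_apply] at hφ ⊢
    rw [← hφ]
    exact Equiv.sum_comp (MulAction.toPerm g⁻¹) φ

/-- The functions of sum zero form a proper subspace, and G acts non-trivially on it: an element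
taking x to y moves δ_x − δ_y. Any non-trivial irreducible constituent will do. -/
theorem exists_isIrreducible_ne_one_lt_card [Finite G] {Ω : Type*} [Finite Ω] [MulAction G Ω]
    [MulAction.IsPretransitive G Ω] [Nontrivial Ω] :
    ∃ m < Nat.card Ω, ∃ σ : Representation ℂ G (Fin m → ℂ), σ.IsIrreducible ∧ σ ≠ 1 := by
  classical
  have := Fintype.ofFinite Ω
  obtain ⟨x, y, hxy⟩ := exists_pair_ne Ω
  obtain ⟨g, hg⟩ := MulAction.exists_smul_eq G x y
  have hne : (permRepSumZero G Ω).toRepresentation ≠ 1 := by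
    intro h
    have hmem : (Pi.single x 1 - Pi.single y 1 : Ω → ℂ) ∈ (permRepSumZero G Ω).toSubmodule := by
      simp [permRepSumZero]
    have h1 : permRep G Ω g (Pi.single x 1 - Pi.single y 1) = Pi.single x 1 - Pi.single y 1 :=
      congrArg Subtype.val (LinearMap.congr_fun (DFunLike.congr_fun h g) ⟨_, hmem⟩)
    have h2 := congrFun h1 y
    have h3 : g⁻¹ • y = x := inv_smul_eq_iff.2 hg.symm
    simp only [permRep, MonoidHom.coe_mk, OneHom.coe_mk, LinearMap.funLeft_apply, h3,
      Pi.sub_apply, Pi.single_eq_same, Pi.single_eq_of_ne hxy, Pi.single_eq_of_ne hxy.symm] at h2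
    norm_num at h2
  have hlt : Module.finrank ℂ (permRepSumZero G Ω).toSubmodule < Nat.card Ω := by
    have := Submodule.finrank_lt (s := (permRepSumZero G Ω).toSubmodule) (fun e => by
      have hx : (Pi.single x 1 : Ω → ℂ) ∈ (permRepSumZero G Ω).toSubmodule := by
        rw [e]; exact Submodule.mem_top
      simp [permRepSumZero] at hx)
    rwa [Module.finrank_fintype_fun_eq_card, ← Nat.card_eq_fintype_card] at this
  obtain ⟨m, hm, h⟩ := Representation.exists_isIrreducible_ne_one _ hne
  exact ⟨m, hm.trans_lt hlt, h⟩

end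

/-! ### Permutation of joint generalised eigenspaces -/

section

/-- The action of a group on the subspaces of a representation. -/
@[reducible] def Representation.submoduleMulAction {k G V : Type*} [Field k] [Group G]
    [AddCommGroup V] [Module k V] (ρ : Representation k G V) : MulAction G (Submodule k V) where
  smul g W := W.map (ρ g)
  one_smul W := by
    change W.map (ρ 1) = W
    rw [map_one, Module.End.one_eq_id, Submodule.map_id]
  mul_smul g h W := by
    change W.map (ρ (g * h)) = (W.map (ρ h)).map (ρ g)
    rw [map_mul, Module.End.mul_eq_comp, Submodule.map_comp]

open Module.End in
/-- If a finite group acts irreducibly and permutes a commuting family of endomorphisms, then it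
acts transitively on a set of at most `dim V` joint generalised eigenspaces. If there is only
one of them, every member of the family has only one eigenvalue. -/
theorem exists_transitive_action_of_commute {G V ι : Type*} [Group G] [Finite G] [AddCommGroup V]
    [Module ℂ V] [FiniteDimensional ℂ V] {ρ : Representation ℂ G V} (hρ : ρ.IsIrreducible)
    [MulAction G ι] (f : ι → Module.End ℂ V) (hcomm : ∀ i j, Commute (f i) (f j))
    (hf : ∀ g i, SemiconjBy (ρ g) (f i) (f (g • i))) :
    ∃ (Ω : Set (Submodule ℂ V)) (_ : MulAction G Ω), Finite Ω ∧ MulAction.IsPretransitive G Ω ∧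
      Nat.card Ω ≤ Module.finrank ℂ V ∧
      (Subsingleton Ω → ∀ i, ∃ c : ℂ, IsNilpotent (f i - algebraMap ℂ (Module.End ℂ V) c)) := by
  let _ : MulAction G (Submodule ℂ V) := ρ.submoduleMulAction
  obtain ⟨hV, hρ⟩ := ρ.isIrreducible_iff.1 hρ
  set W : (ι → ℂ) → Submodule ℂ V := fun χ => ⨅ i, (f i).maxGenEigenspace (χ i) with hW
  have hmaps : ∀ i j φ,
      Set.MapsTo (f i) ((f j).maxGenEigenspace φ) ((f j).maxGenEigenspace φ) :=
    fun i j φ => mapsTo_maxGenEigenspace_of_comm (hcomm j i) φ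
  have htop : ⨆ χ, W χ = ⊤ :=
    iSup_iInf_maxGenEigenspace_eq_top_of_forall_mapsTo f hmaps
      fun i => iSup_maxGenEigenspace_eq_top _
  have hindep : sSupIndep (Set.range W) :=
    (independent_iInf_maxGenEigenspace_of_forall_mapsTo f hmaps).sSupIndep_range
  have hmap_le : ∀ (g : G) χ, (W χ).map (ρ g) ≤ W fun i => χ (g⁻¹ • i) := by
    rintro g χ - ⟨v, hv, rfl⟩
    rw [SetLike.mem_coe, hW, mem_iInf_maxGenEigenspace_iff] at hv
    rw [hW, mem_iInf_maxGenEigenspace_iff]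
    intro i
    obtain ⟨k, hk⟩ := hv (g⁻¹ • i)
    refine ⟨k, ?_⟩
    have h1 : SemiconjBy (ρ g) ((f (g⁻¹ • i) - χ (g⁻¹ • i) • 1) ^ k)
        ((f i - χ (g⁻¹ • i) • 1) ^ k) := by
      refine SemiconjBy.pow_right (SemiconjBy.sub_right ?_ ?_) k
      · simpa using hf g (g⁻¹ • i)
      · simp [SemiconjBy]
    have h2 := LinearMap.congr_fun h1.eq v
    rw [Module.End.mul_apply, Module.End.mul_apply, hk, map_zero] at h2
    exact h2.symm
  have hsmul : ∀ (g : G) χ, g • W χ = W fun i => χ (g⁻¹ • i) := by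
    intro g χ
    refine le_antisymm (hmap_le g χ) ?_
    have h1 : g⁻¹ • (W fun i => χ (g⁻¹ • i)) ≤ W χ := by
      have h0 := hmap_le g⁻¹ fun i => χ (g⁻¹ • i)
      simp only [inv_inv, inv_smul_smul] at h0
      exact h0
    have h2 := Submodule.map_mono (f := ρ g) h1
    change g • g⁻¹ • (W fun i => χ (g⁻¹ • i)) ≤ g • W χ at h2
    rwa [smul_inv_smul] at h2
  -- Ω is the orbit of one non-zero joint eigenspace. Its members are independent and non-zero,
  -- hence at most dim V in number.
  obtain ⟨χ, hχ⟩ : ∃ χ, W χ ≠ ⊥ := by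
    by_contra! h
    simp [h] at htop
  have horbit : MulAction.orbit G (W χ) ⊆ Set.range W := by
    rintro - ⟨g, rfl⟩
    exact ⟨_, (hsmul g χ).symm⟩
  have hne : ∀ U : MulAction.orbit G (W χ), (U : Submodule ℂ V) ≠ ⊥ := by
    rintro ⟨-, g, rfl⟩ h
    apply hχ
    rw [← inv_smul_smul g (W χ)]
    change (g • W χ).map (ρ g⁻¹) = ⊥
    rw [show g • W χ = ⊥ from h, Submodule.map_bot]
  have hfin : Finite (MulAction.orbit G (W χ)) := Set.finite_range _
  refine ⟨MulAction.orbit G (W χ), inferInstance, hfin, inferInstance, ?_, ?_⟩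
  · have hi := (sSupIndep_iff _).1 (hindep.mono horbit)
    have := iSupIndep.fintypeNeBotOfFiniteDimensional hi
    have hcard := hi.subtype_ne_bot_le_finrank
    rw [← Nat.card_eq_fintype_card] at hcard
    rwa [Nat.card_congr (Equiv.subtypeUnivEquiv hne)] at hcard
  · intro hsub i
    have hinv : ∀ g, ∀ v ∈ W χ, ρ g v ∈ W χ := by
      intro g v hv
      have h1 : g • W χ = W χ := congrArg Subtype.val (Subsingleton.elim
        (⟨g • W χ, g, rfl⟩ : MulAction.orbit G (W χ)) ⟨W χ, MulAction.mem_orbit_self _⟩)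
      rw [← h1]
      exact Submodule.mem_map_of_mem hv
    have h2 : (f i).maxGenEigenspace (χ i) = ⊤ :=
      top_le_iff.1 (((hρ _ hinv).resolve_left hχ).ge.trans (iInf_le _ i))
    refine ⟨χ i, Module.finrank ℂ V, ?_⟩
    rw [maxGenEigenspace_eq_genEigenspace_finrank, genEigenspace_nat] at h2
    rw [← LinearMap.ker_eq_top, ← h2]
    rfl

end

/-! ### The two sufficient criteria -/

section
open scoped Matrix.Norms.L2Operator
variable {n : ℕ}

/-- The C*-identity gives ‖A^(2^k)‖ = ‖A‖^(2^k). -/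
theorem eq_zero_of_isNilpotent_of_isSelfAdjoint {A : Matrix (Fin n) (Fin n) ℂ}
    (hA : IsSelfAdjoint A) (h : IsNilpotent A) : A = 0 := by
  obtain ⟨k, hk⟩ := h
  have h1 : A ^ 2 ^ k = 0 := pow_eq_zero_of_le Nat.lt_two_pow_self.le hk
  have h2 := hA.nnnorm_pow_two_pow k
  rw [h1, nnnorm_zero] at h2
  exact nnnorm_eq_zero.1 (pow_eq_zero_iff (by positivity) |>.1 h2.symm)

/-- A nilpotent matrix has trace 0, so −nc = 0 and X is itself nilpotent; then iX is Hermitian and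
nilpotent. -/
theorem eq_zero_of_mem_suLie_of_isNilpotent_sub {X : Matrix (Fin n) (Fin n) ℂ} (hX : X ∈ suLie n)
    {c : ℂ} (h : IsNilpotent (X - c • 1)) : X = 0 := by
  rcases Nat.eq_zero_or_pos n with rfl | hn
  · exact Subsingleton.elim _ _
  have htr := (Matrix.isNilpotent_trace_of_isNilpotent h).eq_zero
  have hc : c = 0 := by simpa [hX.2, hn.ne'] using htr
  rw [hc, zero_smul, sub_zero] at h
  have h1 : Complex.I • X = 0 := by
    refine eq_zero_of_isNilpotent_of_isSelfAdjoint ?_ (h.smul _)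
    change (Complex.I • X)ᴴ = _
    rw [Matrix.conjTranspose_smul, hX.1]
    simp
  exact (smul_eq_zero.1 h1).resolve_left Complex.I_ne_zero

/-- The conjugation action on an invariant subalgebra of matrices. -/
@[reducible] def AdInvariant.mulAction {G : Type*} [Group G]
    {π : G →* Matrix.specialUnitaryGroup (Fin n) ℂ}
    {𝔞 : LieSubalgebra ℝ (Matrix (Fin n) (Fin n) ℂ)} (h : AdInvariant π 𝔞) : MulAction G 𝔞 where
  smul g X := ⟨_, h g X X.2⟩
  one_smul X := Subtype.ext (by
    change (π 1 : Matrix (Fin n) (Fin n) ℂ) * X *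
      ((π 1)⁻¹ : Matrix.specialUnitaryGroup (Fin n) ℂ) = X
    simp)
  mul_smul g k X := Subtype.ext (by
    change (π (g * k) : Matrix (Fin n) (Fin n) ℂ) * X *
      ((π (g * k))⁻¹ : Matrix.specialUnitaryGroup (Fin n) ℂ) =
      (π g : Matrix (Fin n) (Fin n) ℂ) * ((π k : Matrix (Fin n) (Fin n) ℂ) * X *
      ((π k)⁻¹ : Matrix.specialUnitaryGroup (Fin n) ℂ)) *
      ((π g)⁻¹ : Matrix.specialUnitaryGroup (Fin n) ℂ)
    simp [mul_assoc])

theorem exists_transitive_action_of_adInvariant {G : Type*} [Group G] [Finite G]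
    {π : G →* Matrix.specialUnitaryGroup (Fin n) ℂ} (hirr : (repOfSU π).IsIrreducible)
    {𝔞 : LieSubalgebra ℝ (Matrix (Fin n) (Fin n) ℂ)} (hle : 𝔞 ≤ suLie n) (hab : IsLieAbelian 𝔞)
    (hinv : AdInvariant π 𝔞) :
    ∃ (Ω : Set (Submodule ℂ (Fin n → ℂ))) (_ : MulAction G Ω), Finite Ω ∧
      MulAction.IsPretransitive G Ω ∧ Nat.card Ω ≤ n ∧ (Subsingleton Ω → 𝔞 = ⊥) := by
  let _ := hinv.mulAction
  obtain ⟨Ω, hΩ, h1, h2, h3, h4⟩ := exists_transitive_action_of_commute hirr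
    (fun X : 𝔞 => Matrix.toLin' (X : Matrix (Fin n) (Fin n) ℂ)) (fun X Y => by
      change _ * _ = _ * _
      rw [Module.End.mul_eq_comp, Module.End.mul_eq_comp, ← Matrix.toLin'_mul,
        ← Matrix.toLin'_mul, (commute_of_isLieAbelian X.2 Y.2).eq]) (fun g X => by
      change Matrix.toLin' _ * Matrix.toLin' _ = Matrix.toLin' _ * Matrix.toLin' _
      rw [Module.End.mul_eq_comp, Module.End.mul_eq_comp, ← Matrix.toLin'_mul,
        ← Matrix.toLin'_mul]
      congr 1
      change _ = ((π g : Matrix (Fin n) (Fin n) ℂ) * X *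
        ((π g)⁻¹ : Matrix.specialUnitaryGroup (Fin n) ℂ)) * _
      rw [mul_assoc _ _ (π g : Matrix (Fin n) (Fin n) ℂ), coe_inv_mul_coe, mul_one])
  rw [Module.finrank_fin_fun] at h3
  refine ⟨Ω, hΩ, h1, h2, h3, fun hs => (LieSubalgebra.eq_bot_iff _).2 fun X hX => ?_⟩
  obtain ⟨c, hc⟩ := h4 hs ⟨X, hX⟩
  refine eq_zero_of_mem_suLie_of_isNilpotent_sub (hle hX) (c := c) ?_
  have h5 := hc.map (Matrix.toLinAlgEquiv' (R := ℂ) (n := Fin n)).symm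
  have h6 : (Matrix.toLinAlgEquiv' (R := ℂ) (n := Fin n)).symm (Matrix.toLin' X) = X :=
    LinearMap.toMatrix'_toLin' X
  rwa [map_sub, AlgEquiv.commutes, Algebra.algebraMap_eq_smul_one, h6] at h5

theorem abelian_eq_bot_of_forall_perm_hom_trivial {G : Type*} [Group G] [Finite G]
    {π : G →* Matrix.specialUnitaryGroup (Fin n) ℂ} (hirr : (repOfSU π).IsIrreducible)
    (hperm : ∀ f : G →* Equiv.Perm (Fin n), f = 1)
    {𝔞 : LieSubalgebra ℝ (Matrix (Fin n) (Fin n) ℂ)} (hle : 𝔞 ≤ suLie n) (hab : IsLieAbelian 𝔞)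
    (hinv : AdInvariant π 𝔞) : 𝔞 = ⊥ := by
  obtain ⟨Ω, hΩ, h1, h2, h3, h4⟩ := exists_transitive_action_of_adInvariant hirr hle hab hinv
  -- Extending permutations of Ω by the identity embeds Sym(Ω) in Sym(n), so G acts trivially on Ω;
  -- transitivity leaves one point.
  let e : Ω ↪ Fin n := (Finite.equivFin Ω).toEmbedding.trans (Fin.castLEEmb h3)
  have h5 := hperm ((Equiv.Perm.viaEmbeddingHom e).comp (MulAction.toPermHom G Ω))
  have h6 : ∀ (g : G) (ω : Ω), g • ω = ω := by
    intro g ω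
    have h7 : MulAction.toPermHom G Ω g = 1 := Equiv.Perm.viaEmbeddingHom_injective e
      ((DFunLike.congr_fun h5 g).trans (map_one _).symm)
    exact Equiv.congr_fun h7 ω
  refine h4 ⟨fun x y => ?_⟩
  obtain ⟨g, hg⟩ := MulAction.exists_smul_eq G x y
  rw [← hg, h6]

theorem abelian_eq_bot_of_least_dimension {G : Type*} [Group G] [Finite G]
    {π : G →* Matrix.specialUnitaryGroup (Fin n) ℂ} (hirr : (repOfSU π).IsIrreducible)
    (hleast : ∀ (m : ℕ) (ρ : Representation ℂ G (Fin m → ℂ)), ρ.IsIrreducible → ρ ≠ 1 → n ≤ m)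
    {𝔞 : LieSubalgebra ℝ (Matrix (Fin n) (Fin n) ℂ)} (hle : 𝔞 ≤ suLie n) (hab : IsLieAbelian 𝔞)
    (hinv : AdInvariant π 𝔞) : 𝔞 = ⊥ := by
  obtain ⟨Ω, hΩ, h1, h2, h3, h4⟩ := exists_transitive_action_of_adInvariant hirr hle hab hinv
  refine h4 (not_nontrivial_iff_subsingleton.1 fun hnt => ?_)
  obtain ⟨m, hm, σ, hσ, hσ1⟩ := exists_isIrreducible_ne_one_lt_card (G := G) (Ω := Ω)
  exact absurd (hleast m σ hσ hσ1) (by omega)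

end

theorem proposition4p3 {G : Type*} [Group G] [Finite G] (n : ℕ)
    (π : G →* Matrix.specialUnitaryGroup (Fin n) ℂ)
    (hπ : π ≠ 1) (hirr : (repOfSU π).IsIrreducible) :
    -- the two formulations of the assumption on tori agree
    (NormalizesNoTorus π ↔
      ∀ 𝔞 : LieSubalgebra ℝ (Matrix (Fin n) (Fin n) ℂ),
        𝔞 ≤ suLie n → IsLieAbelian 𝔞 → AdInvariant π 𝔞 → 𝔞 = ⊥) ∧
    -- it holds if `G` has no non-trivial homomorphism to `Sym(n)`
    ((∀ f : G →* Equiv.Perm (Fin n), f = 1) → NormalizesNoTorus π) ∧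
    -- it holds if `n` is the least dimension of a non-trivial irreducible representation of `G`
    ((∀ (m : ℕ) (ρ : Representation ℂ G (Fin m → ℂ)), ρ.IsIrreducible → ρ ≠ 1 → n ≤ m) →
      NormalizesNoTorus π) ∧
    -- under the assumption, uniform discreteness and a maximal discrete (finite) overgroup
    (NormalizesNoTorus π →
      UniformlyDiscrete
        {H : Subgroup (PU n) | DiscreteTopology H ∧ ((toPU n).comp π).range ≤ H} ∧
      ∃ M : Subgroup (PU n),
        IsMaximalDiscrete M ∧ Finite M ∧ ((toPU n).comp π).range ≤ M) := by
  refine ⟨⟨abelian_eq_bot_of_normalizesNoTorus π, normalizesNoTorus_of_forall_abelian_eq_bot π⟩,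
    fun h => normalizesNoTorus_of_forall_abelian_eq_bot π fun _ =>
      abelian_eq_bot_of_forall_perm_hom_trivial hirr h,
    fun h => normalizesNoTorus_of_forall_abelian_eq_bot π fun _ =>
      abelian_eq_bot_of_least_dimension hirr h, fun h => ?_⟩
  have hud := uniformlyDiscrete_of_forall_abelian_eq_bot π (abelian_eq_bot_of_normalizesNoTorus π h)
  have : Finite ((toPU n).comp π).range := Set.finite_range _
  exact ⟨hud, exists_isMaximalDiscrete hud⟩

end
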